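/- **Theorem 3.13 (Quantitative Prokhorov's Theorem).** A *cdf* is a non-decreasing right-continuous function $F:\mathbb R\to\mathbb R$ with $\lim_{x\to-\infty}F(x)=0$ and $\lim_{x\to\infty}F(x)=1$. Let $\mathcal F$ be the set of all cdfs, $\mathcal F_c$ the set of continuous ones, $D_u(F,G)=\sup_{x\in\mathbb R}|F(x)-G(x)|$, and $(F\star G)(x)=\int_{-\infty}^{\infty}F(x-y)\,dG(y)$. An *approach system* on a set $X$ assigns to each $x\in X$ a nonempty set $\mathcal A_x$ of functions $X\to[0,\infty]$, closed under finite suprema and under passing to smaller functions, such that (i) $\phi(x)=0$ for all $\phi\in\mathcal A_x$; (ii) if $\phi:X\to[0,\infty]$ is such that for all $\epsilon>0$ and $\omega<\infty$ there is $\psi\in\mathcal A_x$ with $\min\{\phi,\omega\}\le\psi+\epsilon$, then $\phi\in\mathcal A_x$; (iii) for all $\phi\in\mathcal A_x$, $\epsilon>0$, $\omega<\infty$ there is $(\phi_z)_{z\in X}$ with $\phi_z\in\mathcal A_z$ for every $z\in X$ and $\min\{\phi(y),\omega\}\le\phi_x(z)+\phi_z(y)+\epsilon$ for all $y,z\in X$.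 A metric $d$ on $X$ gives the approach system with $\mathcal A_x=\{\phi\mid\phi\le d(x,\cdot)\}$. Given maps $f_i:X\to Y_i$ into sets with approach systems, the *initial* approach system on $X$ is the one for which $\phi\in\mathcal A_x$ if and only if for all $\epsilon>0$ and $\omega<\infty$ there are a finite set $J$ of indices and $\psi_i\in(\mathcal A_{Y_i})_{f_i(x)}$ ($i\in J$) with $\min\{\phi,\omega\}\le\sup_{i\in J}\psi_i\circ f_i+\epsilon$. The *continuity approach structure* $\mathcal A_c$ on $\mathcal F$ is the initial approach system for the maps $\mathcal F\to\mathcal F_c$, $F\mapsto F\star G$, with $G$ running through $\mathcal F_c$, where $\mathcal F_c$ carries the approach system of the metric $D_u$. For an approach system $\mathcal A$ on $X$ and $\alpha>0$, a sequence $(x_n)$ is *$\alpha$-convergent* to $x$ if for every $\phi\in\mathcal A_x$ one has $\phi(x_n)<\alpha$ for all sufficiently large $n$. A set $A\subset X$ is *$\alpha$-relatively sequentially compact* if every sequence in $A$ has a subsequence that is $\alpha$-convergent to some point of $X$; put $\chi_{rsc}(A)=\inf\{\alpha>0\mid A\text{ is }\alpha\text{-relatively sequentially compact}\}$. Then for every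 set $\mathcal D\subset\mathcal F$, with $\chi_{rsc}$ taken in $(\mathcal F,\mathcal A_c)$, $$\chi_{rsc}(\mathcal D)=\chi_e(\mathcal D):=\inf_{M>0}\ \sup_{F\in\mathcal D}\ \max\{F(-M),\,1-F(M)\},$$ where the supremum over the empty set is taken to be $0$. -/

import Mathlib

open Filter Topology MeasureTheory
open scoped ENNReal

noncomputable section

/-- An approach system on `X`: to each point `x` an ideal `system x` of functions `X → [0,∞]`
(nonempty, closed under binary suprema and under passing to smaller functions) of local distances
from `x`, which vanish at `x`, is saturated, and satisfies the mixed triangle inequality. -/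
structure ApproachSystem (X : Type*) where
  system : X → Set (X → ℝ≥0∞)
  nonempty : ∀ x, (system x).Nonempty
  sup_mem : ∀ x, ∀ φ ∈ system x, ∀ ψ ∈ system x, φ ⊔ ψ ∈ system x
  mem_of_le : ∀ x, ∀ φ ∈ system x, ∀ ψ, ψ ≤ φ → ψ ∈ system x
  apply_self : ∀ x, ∀ φ ∈ system x, φ x = 0
  saturated : ∀ x (φ : X → ℝ≥0∞),
    (∀ ε : ℝ≥0∞, 0 < ε → ∀ ω : ℝ≥0∞, ω < ∞ →
      ∃ ψ ∈ system x, ∀ y, min (φ y) ω ≤ ψ y + ε) → φ ∈ system x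
  triangle : ∀ x, ∀ φ ∈ system x, ∀ ε : ℝ≥0∞, 0 < ε → ∀ ω : ℝ≥0∞, ω < ∞ →
    ∃ Φ : X → X → ℝ≥0∞, (∀ z, Φ z ∈ system z) ∧
      ∀ z y, min (φ y) ω ≤ Φ x z + Φ z y + ε

namespace ApproachSystem

/-- The sequence `u` is `ε`-convergent to `x`: every ball with center `x` and radius `ε`, that is,
every set `{y | φ y < ε}` with `φ` in the approach system at `x`, contains `u n` for all
sufficiently large `n`. -/
def ConvergesUpTo {X : Type*} (S : ApproachSystem X) (ε : ℝ) (u : ℕ → X) (x : X) : Prop :=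
  ∀ φ ∈ S.system x, ∀ᶠ n in atTop, φ (u n) < ENNReal.ofReal ε

/-- `A` is `ε`-relatively sequentially compact: each sequence in `A` has a subsequence which is
`ε`-convergent to some point of the space. -/
def IsRelSeqCompactUpTo {X : Type*} (S : ApproachSystem X) (ε : ℝ) (A : Set X) : Prop :=
  ∀ u : ℕ → X, (∀ n, u n ∈ A) →
    ∃ k : ℕ → ℕ, StrictMono k ∧ ∃ x : X, S.ConvergesUpTo ε (u ∘ k) x

/-- The relative sequential compactness index of `A`, with values in `[0,∞]`. -/
def relSeqCompactIndex {X : Type*} (S : ApproachSystem X) (A : Set X) : ℝ≥0∞ :=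
  ⨅ (α : ℝ) (_ : 0 < α) (_ : S.IsRelSeqCompactUpTo α A), ENNReal.ofReal α

/-- The approach system underlying a `[0,∞]`-valued (quasi-)metric `d`: the local distances at `x`
are the functions below `d x`. -/
def ofDist {X : Type*} (d : X → X → ℝ≥0∞) (d_self : ∀ x, d x x = 0)
    (d_triangle : ∀ x z y, d x y ≤ d x z + d z y) : ApproachSystem X where
  system x := {φ | φ ≤ d x}
  nonempty x := ⟨d x, le_refl (d x)⟩
  sup_mem x φ hφ ψ hψ := show φ ⊔ ψ ≤ d x from sup_le hφ hψ
  mem_of_le _ _ hφ _ hle := le_trans hle hφ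
  apply_self x φ hφ := le_antisymm (le_trans (hφ x) (d_self x).le) bot_le
  saturated x φ h := by
    intro y
    refine le_of_forall_lt fun c hc => ?_
    obtain ⟨ω, hcω, hω⟩ := exists_between hc
    refine lt_of_lt_of_le hcω ?_
    refine ENNReal.le_of_forall_pos_le_add fun ε hε _ => ?_
    obtain ⟨ψ, hψ, hle⟩ := h ε (by exact_mod_cast hε) ω (lt_of_lt_of_le hω le_top)
    have h1 := hle y
    rw [min_eq_right hω.le] at h1
    exact h1.trans (by gcongr; exact hψ y)
  triangle x φ hφ ε _ ω _ :=
    ⟨d, fun z => le_refl (d z), fun z y =>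
      (min_le_left _ _).trans ((hφ y).trans ((d_triangle x z y).trans le_self_add))⟩

/-- The finite suprema of the functions `ψ ∘ f i`, where `ψ` is a local distance at `f i x`: the
standard basis at `x` of the initial approach system. -/
def initialBasis {X ι : Type*} {Y : ι → Type*} (S : ∀ i, ApproachSystem (Y i))
    (f : ∀ i, X → Y i) (x : X) : Set (X → ℝ≥0∞) :=
  {b | ∃ (J : Finset ι) (ψ : ∀ i, Y i → ℝ≥0∞),
    (∀ i ∈ J, ψ i ∈ (S i).system (f i x)) ∧ b = fun y => J.sup fun i => ψ i (f i y)}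

theorem sup_mem_initialBasis {X ι : Type*} {Y : ι → Type*} (S : ∀ i, ApproachSystem (Y i))
    (f : ∀ i, X → Y i) (x : X) {b c : X → ℝ≥0∞} (hb : b ∈ initialBasis S f x)
    (hc : c ∈ initialBasis S f x) : b ⊔ c ∈ initialBasis S f x := by
  classical
  obtain ⟨J, ψ, hψ, rfl⟩ := hb
  obtain ⟨K, θ, hθ, rfl⟩ := hc
  refine ⟨J ∪ K, fun i => (if i ∈ J then ψ i else ⊥) ⊔ (if i ∈ K then θ i else ⊥), ?_, ?_⟩
  · intro i hi
    by_cases h1 : i ∈ J <;> by_cases h2 : i ∈ K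
    · simpa [h1, h2] using (S i).sup_mem _ _ (hψ i h1) _ (hθ i h2)
    · simpa [h1, h2] using hψ i h1
    · simpa [h1, h2] using hθ i h2
    · simp [h1, h2] at hi
  · funext y
    apply le_antisymm
    · refine sup_le (Finset.sup_le fun i hi => ?_) (Finset.sup_le fun i hi => ?_)
      · refine le_trans ?_ (Finset.le_sup (Finset.mem_union_left K hi))
        simp [hi]
      · refine le_trans ?_ (Finset.le_sup (Finset.mem_union_right J hi))
        simp [hi]
    · refine Finset.sup_le fun i hi => ?_
      refine sup_le ?_ ?_
      · by_cases h1 : i ∈ J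
        · simp only [h1, if_true]
          exact le_sup_of_le_left (Finset.le_sup (f := fun i => ψ i (f i y)) h1)
        · simp [h1]
      · by_cases h1 : i ∈ K
        · simp only [h1, if_true]
          exact le_sup_of_le_right (Finset.le_sup (f := fun i => θ i (f i y)) h1)
        · simp [h1]

/-- The initial approach system on `X` for the source `(f i : X → (Y i, S i))`, i.e. the saturation
of `initialBasis`. -/
def initial {X ι : Type*} {Y : ι → Type*} (S : ∀ i, ApproachSystem (Y i))
    (f : ∀ i, X → Y i) : ApproachSystem X where
  system x := {φ | ∀ ε : ℝ≥0∞, 0 < ε → ∀ ω : ℝ≥0∞, ω < ∞ →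
    ∃ b ∈ initialBasis S f x, ∀ y, min (φ y) ω ≤ b y + ε}
  nonempty x := by
    refine ⟨fun _ => 0, fun ε _ ω _ => ⟨_, ⟨∅, fun _ _ => 0, by simp, rfl⟩, fun y => by simp⟩⟩
  sup_mem x φ hφ ψ hψ ε hε ω hω := by
    obtain ⟨b, hb, hle⟩ := hφ ε hε ω hω
    obtain ⟨c, hc, hle'⟩ := hψ ε hε ω hω
    refine ⟨b ⊔ c, sup_mem_initialBasis S f x hb hc, fun y => ?_⟩
    simp only [Pi.sup_apply, min_max_distrib_right]
    refine sup_le ((hle y).trans ?_) ((hle' y).trans ?_)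
    · gcongr; exact le_sup_left
    · gcongr; exact le_sup_right
  mem_of_le x φ hφ ψ hψ ε hε ω hω := by
    obtain ⟨b, hb, hle⟩ := hφ ε hε ω hω
    exact ⟨b, hb, fun y => (min_le_min_right ω (hψ y)).trans (hle y)⟩
  apply_self x φ hφ := by
    have key : min (φ x) 1 ≤ 0 := by
      refine ENNReal.le_of_forall_pos_le_add fun ε hε _ => ?_
      obtain ⟨b, ⟨J, ψ, hψ, rfl⟩, hle⟩ := hφ ε (by exact_mod_cast hε) 1 ENNReal.one_lt_top
      refine (hle x).trans ?_
      gcongr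
      exact Finset.sup_le fun i hi => ((S i).apply_self _ _ (hψ i hi)).le
    rcases min_le_iff.1 key with h | h
    · exact le_antisymm h bot_le
    · simp at h
  saturated x φ h ε hε ω hω := by
    obtain ⟨ψ, hψ, hle⟩ := h (ε / 2) (ENNReal.half_pos hε.ne') ω hω
    obtain ⟨b, hb, hle'⟩ := hψ (ε / 2) (ENNReal.half_pos hε.ne') ω hω
    refine ⟨b, hb, fun y => ?_⟩
    have h1 : min (φ y) ω ≤ min (ψ y) ω + ε / 2 := by
      rcases le_total (ψ y) ω with h0 | h0
      · rw [min_eq_left h0]; exact hle y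
      · rw [min_eq_right h0]; exact (min_le_right _ _).trans le_self_add
    calc min (φ y) ω ≤ min (ψ y) ω + ε / 2 := h1
      _ ≤ (b y + ε / 2) + ε / 2 := by gcongr; exact hle' y
      _ = b y + ε := by rw [add_assoc, ENNReal.add_halves]
  triangle x φ hφ ε hε ω hω := by
    classical
    obtain ⟨b, ⟨J, ψ, hψ, rfl⟩, hle⟩ := hφ (ε / 2) (ENNReal.half_pos hε.ne') ω hω
    have tri : ∀ i, ∃ Φ : Y i → Y i → ℝ≥0∞, (∀ z, Φ z ∈ (S i).system z) ∧
        (i ∈ J → ∀ z y, min (ψ i y) ω ≤ Φ (f i x) z + Φ z y + ε / 2) := by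
      intro i
      by_cases hi : i ∈ J
      · obtain ⟨Φ, h1, h2⟩ :=
          (S i).triangle _ _ (hψ i hi) (ε / 2) (ENNReal.half_pos hε.ne') ω hω
        exact ⟨Φ, h1, fun _ => h2⟩
      · choose Φ hΦ using (S i).nonempty
        exact ⟨Φ, hΦ, fun h => absurd h hi⟩
    choose Θ hΘ hΘle using tri
    refine ⟨fun z y => J.sup fun i => Θ i (f i z) (f i y), fun z ε' _ ω' _ => ?_, fun z y => ?_⟩
    · exact ⟨_, ⟨J, fun i => Θ i (f i z), fun i _ => hΘ i _, rfl⟩,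
        fun y => (min_le_left _ _).trans le_self_add⟩
    · have h1 : min (φ y) ω ≤ min (J.sup fun i => ψ i (f i y)) ω + ε / 2 := by
        rcases le_total (J.sup fun i => ψ i (f i y)) ω with h0 | h0
        · rw [min_eq_left h0]; exact hle y
        · rw [min_eq_right h0]; exact (min_le_right _ _).trans le_self_add
      have h2 : min (J.sup fun i => ψ i (f i y)) ω ≤
          (J.sup fun i => Θ i (f i x) (f i z)) + (J.sup fun i => Θ i (f i z) (f i y))
            + ε / 2 := by
        rw [Finset.sup_inf_distrib_right]
        refine Finset.sup_le fun i hi => (hΘle i hi (f i z) (f i y)).trans ?_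
        gcongr
        · exact Finset.le_sup (f := fun i => Θ i (f i x) (f i z)) hi
        · exact Finset.le_sup (f := fun i => Θ i (f i z) (f i y)) hi
      calc min (φ y) ω ≤ min (J.sup fun i => ψ i (f i y)) ω + ε / 2 := h1
        _ ≤ (((J.sup fun i => Θ i (f i x) (f i z)) + (J.sup fun i => Θ i (f i z) (f i y)))
            + ε / 2) + ε / 2 := by gcongr
        _ = _ := by rw [add_assoc _ (ε / 2), ENNReal.add_halves]

/-- Contractions, the morphisms of approach spaces. -/
def IsContraction {X Y : Type*} (S : ApproachSystem X) (T : ApproachSystem Y) (f : X → Y) :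
    Prop :=
  ∀ x, ∀ φ ∈ T.system (f x), φ ∘ f ∈ S.system x

/-- The universal property of the initial approach system: `g` into it is a contraction if and
only if all the maps `f i ∘ g` are. -/
theorem isContraction_initial_iff {X Z ι : Type*} {Y : ι → Type*}
    (S : ∀ i, ApproachSystem (Y i)) (f : ∀ i, X → Y i) (T : ApproachSystem Z) (g : Z → X) :
    T.IsContraction (initial S f) g ↔ ∀ i, T.IsContraction (S i) (f i ∘ g) := by
  constructor
  · intro h i z φ hφ
    refine h z (φ ∘ f i) fun ε _ ω _ => ?_
    classical
    refine ⟨_, ⟨{i}, fun j => if e : j = i then e ▸ φ else ⊥, ?_, rfl⟩, fun y => ?_⟩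
    · intro j hj
      obtain rfl := Finset.mem_singleton.1 hj
      simpa using hφ
    · simp
  · intro h z φ hφ
    refine T.saturated z _ fun ε hε ω hω => ?_
    obtain ⟨b, ⟨J, ψ, hψ, rfl⟩, hle⟩ := hφ ε hε ω hω
    refine ⟨fun w => J.sup fun i => ψ i (f i (g w)), ?_, fun w => hle (g w)⟩
    clear hle
    classical
    induction J using Finset.induction_on with
    | empty =>
      obtain ⟨θ, hθ⟩ := T.nonempty z
      exact T.mem_of_le z θ hθ _ (fun w => by simp)
    | insert i J _ ih =>
      simp only [Finset.sup_insert]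
      exact T.sup_mem z _ (h i z _ (hψ i (Finset.mem_insert_self i J))) _
        (ih fun j hj => hψ j (Finset.mem_insert_of_mem hj))

end ApproachSystem

/-- A cumulative distribution function: a non-decreasing right-continuous function `ℝ → ℝ`
(`StieltjesFunction ℝ`) with limit `0` at `-∞` and limit `1` at `∞`. -/
structure CDF extends StieltjesFunction ℝ where
  tendsto_atBot : Tendsto toStieltjesFunction atBot (𝓝 0)
  tendsto_atTop : Tendsto toStieltjesFunction atTop (𝓝 1)

namespace CDF

instance : CoeFun CDF (fun _ => ℝ → ℝ) := ⟨fun F => F.toStieltjesFunction⟩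

theorem nonneg (F : CDF) (x : ℝ) : 0 ≤ F x :=
  F.mono.le_of_tendsto F.tendsto_atBot x

theorem le_one (F : CDF) (x : ℝ) : F x ≤ 1 :=
  F.mono.ge_of_tendsto F.tendsto_atTop x

/-- The Lebesgue-Stieltjes measure `dF`. -/
def measure (F : CDF) : Measure ℝ := F.toStieltjesFunction.measure

instance (F : CDF) : IsProbabilityMeasure F.measure :=
  F.toStieltjesFunction.isProbabilityMeasure F.tendsto_atBot F.tendsto_atTop

theorem norm_le_one (F : CDF) (x : ℝ) : ‖F x‖ ≤ 1 := by
  rw [Real.norm_eq_abs, abs_of_nonneg (F.nonneg x)]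
  exact F.le_one x

theorem measurable_shift (F : CDF) (x : ℝ) : Measurable fun y => F (x - y) :=
  F.mono.measurable.comp (measurable_const.sub measurable_id)

theorem integrable_shift (F G : CDF) (x : ℝ) : Integrable (fun y => F (x - y)) G.measure :=
  (integrable_const (1 : ℝ)).mono' (F.measurable_shift x).aestronglyMeasurable
    (ae_of_all _ fun _ => F.norm_le_one _)

theorem tendsto_integral_shift (F G : CDF) {l : Filter ℝ} [l.IsCountablyGenerated] {g : ℝ → ℝ}
    (h : ∀ᵐ y ∂G.measure, Tendsto (fun x => F (x - y)) l (𝓝 (g y))) :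
    Tendsto (fun x => ∫ y, F (x - y) ∂G.measure) l (𝓝 (∫ y, g y ∂G.measure)) :=
  tendsto_integral_filter_of_dominated_convergence (fun _ => (1 : ℝ))
    (Eventually.of_forall fun x => (F.measurable_shift x).aestronglyMeasurable)
    (Eventually.of_forall fun _ => ae_of_all _ fun _ => F.norm_le_one _)
    (integrable_const _) h

/-- The convolution product `F ⋆ G = ∫ F (· - y) dG(y)`. -/
def conv (F G : CDF) : CDF where
  toFun x := ∫ y, F (x - y) ∂G.measure
  mono' x₁ x₂ h := integral_mono (F.integrable_shift G x₁) (F.integrable_shift G x₂)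
    fun y => F.mono (sub_le_sub_right h y)
  right_continuous' x := by
    refine F.tendsto_integral_shift G (ae_of_all _ fun y => ?_)
    refine Tendsto.comp (F.right_continuous (x - y)) ?_
    refine tendsto_nhdsWithin_iff.2 ⟨?_, ?_⟩
    · exact ((continuous_id.sub continuous_const).tendsto x).mono_left nhdsWithin_le_nhds
    · filter_upwards [self_mem_nhdsWithin] with z hz
      exact sub_le_sub_right hz y
  tendsto_atBot := by
    have := F.tendsto_integral_shift G (l := atBot) (g := fun _ => 0) (ae_of_all _ fun y =>
      F.tendsto_atBot.comp (tendsto_atBot_add_const_right _ (-y) tendsto_id))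
    simpa using this
  tendsto_atTop := by
    have := F.tendsto_integral_shift G (l := atTop) (g := fun _ => 1) (ae_of_all _ fun y =>
      F.tendsto_atTop.comp (tendsto_atTop_add_const_right _ (-y) tendsto_id))
    simpa using this

theorem continuous_conv (F G : CDF) (hG : Continuous G) : Continuous (F.conv G) := by
  refine continuous_iff_continuousAt.2 fun x => ?_
  refine F.tendsto_integral_shift G ?_
  have hcount : {y : ℝ | ¬ ContinuousAt F (x - y)}.Countable :=
    (F.mono.countable_not_continuousAt).preimage (f := fun y : ℝ => x - y)
      (fun a b h => by simpa using h)
  have : NullSingletonClass G.measure := ⟨fun a => by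
    rw [measure, StieltjesFunction.measure_singleton,
      hG.continuousAt.continuousWithinAt.leftLim_eq]
    simp⟩
  filter_upwards [hcount.ae_notMem G.measure] with y hy
  have hy' : ContinuousAt F (x - y) := by simpa using hy
  exact Tendsto.comp hy' ((continuous_id.sub continuous_const).tendsto x)

/-- The uniform distance `sup_x |F x - G x|`, as an element of `[0,∞]`. -/
def uniformDist (F G : CDF) : ℝ≥0∞ := ⨆ x : ℝ, ENNReal.ofReal |F x - G x|

theorem uniformDist_self (F : CDF) : uniformDist F F = 0 := by
  simp [uniformDist]

theorem uniformDist_triangle (F H G : CDF) :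
    uniformDist F G ≤ uniformDist F H + uniformDist H G := by
  refine iSup_le fun x => ?_
  calc ENNReal.ofReal |F x - G x| ≤ ENNReal.ofReal (|F x - H x| + |H x - G x|) :=
        ENNReal.ofReal_le_ofReal (abs_sub_le _ _ _)
    _ ≤ ENNReal.ofReal |F x - H x| + ENNReal.ofReal |H x - G x| := ENNReal.ofReal_add_le
    _ ≤ _ := add_le_add (le_iSup (fun x => ENNReal.ofReal |F x - H x|) x)
        (le_iSup (fun x => ENNReal.ofReal |H x - G x|) x)

end CDF

/-- The continuous cdfs. -/
abbrev ContCDF : Type := {F : CDF // Continuous F}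

/-- The approach system of the uniform distance on the continuous cdfs. -/
def uniformApproach : ApproachSystem ContCDF :=
  ApproachSystem.ofDist (fun F G => CDF.uniformDist F.1 G.1)
    (fun F => CDF.uniformDist_self F.1) (fun F H G => CDF.uniformDist_triangle F.1 H.1 G.1)

/-- The continuity approach structure on the set of all cdfs: the initial approach structure for
the source `F ↦ F ⋆ G` into the continuous cdfs with the uniform distance, where `G` runs through
the continuous cdfs. -/
def continuityApproach : ApproachSystem CDF :=
  ApproachSystem.initial (ι := ContCDF) (Y := fun _ => ContCDF) (fun _ => uniformApproach)
    (fun G F => ⟨F.conv G.1, F.continuous_conv G.1 G.2⟩)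

/-- The escape index `inf_{M > 0} sup_{F ∈ D} max {F (-M), 1 - F M}`, computed in `[0,∞]` (so that
the supremum over the empty set is `0`). -/
def escapeIndex (D : Set CDF) : ℝ≥0∞ :=
  ⨅ (M : ℝ) (_ : 0 < M), ⨆ F ∈ D, ENNReal.ofReal (max (F (-M)) (1 - F M))

end

/-!
Write `F.tailMass M = max (F (-M)) (1 - F M)`. Moving the mass of `F` outside `[-M, M]` to the
endpoints changes `F` by at most `F.tailMass M` uniformly, and convolution does not increase the
uniform distance. The modified cdfs live on a compact interval, so the classical Prokhorov theorem
provides weakly convergent subsequences; after convolution with a continuous cdf, weak convergence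
becomes pointwise convergence to a continuous cdf, which is uniform by Pólya's theorem.

Conversely, a uniform bound `α` on the distance between `F ⋆ G` and `H ⋆ G`, where `G` is the
uniform distribution on `[0, 1]`, controls the tails of `H` by those of `F ⋆ G` up to `α`.
-/

open Set

namespace ApproachSystem

variable {X Y ι : Type*} {Z : ι → Type*} {α ε : ℝ} {u : ℕ → X} {x : X}

theorem IsContraction.convergesUpTo {S : ApproachSystem X} {T : ApproachSystem Y} {f : X → Y}
    (hf : S.IsContraction T f) (hu : S.ConvergesUpTo ε u x) :
    T.ConvergesUpTo ε (f ∘ u) (f x) :=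
  fun φ hφ => hu (φ ∘ f) (hf x φ hφ)

theorem isContraction_initial (S : ∀ i, ApproachSystem (Z i)) (f : ∀ i, X → Z i) (i : ι) :
    (initial S f).IsContraction (S i) (f i) :=
  (isContraction_initial_iff S f (initial S f) id).1 (fun _ _ h => h) i

/-- The strict inequality `α < ε` leaves room for the error term in the saturation of the initial
basis. -/
theorem convergesUpTo_initial_of_lt (S : ∀ i, ApproachSystem (Z i)) (f : ∀ i, X → Z i)
    (hε : 0 < ε) (hαε : α < ε) (h : ∀ i, (S i).ConvergesUpTo α (f i ∘ u) (f i x)) :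
    (initial S f).ConvergesUpTo ε u x := by
  intro φ hφ
  obtain ⟨δ, hδ, hδε⟩ := ENNReal.lt_iff_exists_add_pos_lt.1
    ((ENNReal.ofReal_lt_ofReal_iff hε).2 hαε)
  obtain ⟨b, ⟨J, ψ, hψ, rfl⟩, hle⟩ :=
    hφ δ (ENNReal.coe_pos.2 hδ) (ENNReal.ofReal ε) ENNReal.ofReal_lt_top
  filter_upwards [(Finset.eventually_all J).2 fun i hi => h i (ψ i) (hψ i hi)] with n hn
  have hmin : min (φ (u n)) (ENNReal.ofReal ε) < ENNReal.ofReal ε :=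
    calc min (φ (u n)) (ENNReal.ofReal ε)
        ≤ (J.sup fun i => ψ i (f i (u n))) + δ := hle (u n)
      _ ≤ ENNReal.ofReal α + δ := by
          gcongr
          exact Finset.sup_le fun i hi => (hn i hi).le
      _ < ENNReal.ofReal ε := hδε
  exact (min_lt_iff.1 hmin).resolve_right (lt_irrefl _)

theorem convergesUpTo_ofDist_iff {d : X → X → ℝ≥0∞} {d_self : ∀ x, d x x = 0}
    {d_triangle : ∀ x z y, d x y ≤ d x z + d z y} :
    (ofDist d d_self d_triangle).ConvergesUpTo ε u x ↔
      ∀ᶠ n in atTop, d x (u n) < ENNReal.ofReal ε :=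
  ⟨fun h => h (d x) (le_refl (d x)), fun h _ hφ => h.mono fun n hn => (hφ (u n)).trans_lt hn⟩

end ApproachSystem

theorem tendstoLocallyUniformly_of_monotone {α ι : Type*} [LinearOrder α] [TopologicalSpace α]
    [OrderTopology α] {l : Filter ι} {u : ι → α → ℝ} {f : α → ℝ} (hu : ∀ i, Monotone (u i))
    (hf : Continuous f) (hlim : ∀ x, Tendsto (fun i => u i x) l (𝓝 (f x))) :
    TendstoLocallyUniformly u f l := by
  rw [Metric.tendstoLocallyUniformly_iff]
  intro ε hε x
  have hclose : ∀ y, ∀ᶠ i in l, |u i y - f y| < ε / 3 := fun y =>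
    (hlim y).eventually (Metric.ball_mem_nhds _ (by positivity))
  obtain ⟨b, c, hx, hnhds, hsub⟩ :=
    exists_Icc_mem_subset_of_mem_nhds (hf.continuousAt (Metric.ball_mem_nhds (f x)
      (show 0 < ε / 3 by positivity)))
  have hosc : ∀ y ∈ Icc b c, |f y - f x| < ε / 3 := fun y hy => hsub hy
  have hbc : b ≤ c := hx.1.trans hx.2
  have hb := abs_lt.1 (hosc b (left_mem_Icc.2 hbc))
  have hc := abs_lt.1 (hosc c (right_mem_Icc.2 hbc))
  refine ⟨Icc b c, hnhds, ?_⟩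
  filter_upwards [hclose b, hclose c] with i hib hic y hy
  rw [abs_lt] at hib hic
  have hy' := abs_lt.1 (hosc y hy)
  have hby : u i b ≤ u i y := hu i hy.1
  have hyc : u i y ≤ u i c := hu i hy.2
  rw [Real.dist_eq, abs_lt]
  constructor <;> linarith

namespace CDF

variable {ι : Type*} {l : Filter ι} {F G H : CDF}

/-- **Pólya's theorem** -/
theorem tendstoUniformly_of_tendsto {u : ι → CDF} (hF : Continuous F)
    (hlim : ∀ x, Tendsto (fun i => u i x) l (𝓝 (F x))) :
    TendstoUniformly (fun i x => u i x) F l := by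
  rw [Metric.tendstoUniformly_iff]
  intro ε hε
  have hclose : ∀ y, ∀ᶠ i in l, |u i y - F y| < ε / 2 := fun y =>
    (hlim y).eventually (Metric.ball_mem_nhds _ (half_pos hε))
  obtain ⟨a, ha⟩ := (F.tendsto_atBot.eventually (gt_mem_nhds (half_pos hε))).exists
  obtain ⟨b, hb⟩ := (F.tendsto_atTop.eventually
    (lt_mem_nhds (sub_lt_self (1 : ℝ) (half_pos hε)))).exists
  have hmid : TendstoUniformlyOn (fun i x => u i x) F l (Icc a b) :=
    (tendstoLocallyUniformlyOn_iff_tendstoUniformlyOn_of_compact isCompact_Icc).1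
      (tendstoLocallyUniformly_of_monotone (fun i => (u i).mono) hF
        hlim).tendstoLocallyUniformlyOn
  filter_upwards [Metric.tendstoUniformlyOn_iff.1 hmid ε hε, hclose a, hclose b]
    with i hi hia hib x
  rw [abs_lt] at hia hib
  rcases le_or_gt x a with hxa | hxa
  · rw [Real.dist_eq, abs_lt]
    constructor <;> linarith [(u i).mono hxa, F.mono hxa, F.nonneg x, (u i).nonneg x]
  rcases le_or_gt x b with hxb | hxb
  · exact hi x ⟨hxa.le, hxb⟩
  · rw [Real.dist_eq, abs_lt]
    constructor <;> linarith [(u i).mono hxb.le, F.mono hxb.le, F.le_one x, (u i).le_one x]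

theorem tendsto_uniformDist_of_tendstoUniformly {u : ι → CDF}
    (h : TendstoUniformly (fun i x => u i x) F l) :
    Tendsto (fun i => uniformDist F (u i)) l (𝓝 0) := by
  refine ENNReal.tendsto_nhds_zero.2 fun ε hε => ?_
  filter_upwards [EMetric.tendstoUniformly_iff.1 h ε hε] with i hi
  refine iSup_le fun x => ?_
  rw [← Real.dist_eq, ← edist_dist]
  exact (hi x).le

theorem uniformDist_comm (F G : CDF) : uniformDist F G = uniformDist G F := by
  simp only [uniformDist, abs_sub_comm]

theorem uniformDist_conv_le (F H G : CDF) :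
    uniformDist (F.conv G) (H.conv G) ≤ uniformDist F H := by
  refine iSup_le fun x => ?_
  calc ENNReal.ofReal |F.conv G x - H.conv G x|
      = ‖∫ y, (F (x - y) - H (x - y)) ∂G.measure‖ₑ := by
        rw [integral_sub (F.integrable_shift G x) (H.integrable_shift G x),
          Real.enorm_eq_ofReal_abs]
        rfl
    _ ≤ ∫⁻ y, ‖F (x - y) - H (x - y)‖ₑ ∂G.measure := enorm_integral_le_lintegral_enorm _
    _ ≤ ∫⁻ _, uniformDist F H ∂G.measure := by
        refine lintegral_mono fun y => ?_
        rw [Real.enorm_eq_ofReal_abs]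
        exact le_iSup (fun z => ENNReal.ofReal |F z - H z|) (x - y)
    _ = uniformDist F H := by simp

theorem measureReal_Iic (F : CDF) (x : ℝ) : F.measure.real (Iic x) = F x := by
  rw [measureReal_def, measure, StieltjesFunction.measure_Iic _ F.tendsto_atBot, sub_zero,
    ENNReal.toReal_ofReal (F.nonneg x)]

theorem conv_apply_eq_measureReal (F G : CDF) (x : ℝ) :
    F.conv G x = (G.measure ∗ F.measure).real (Iic x) := by
  rw [← integral_indicator_one measurableSet_Iic,
    integral_conv ((integrable_const 1).indicator measurableSet_Iic)]
  refine integral_congr_ae (ae_of_all _ fun y => ?_)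
  have hshift : (fun t => (Iic x).indicator (1 : ℝ → ℝ) (y + t)) = (Iic (x - y)).indicator 1 := by
    ext t
    simp only [indicator_apply, mem_Iic, le_sub_iff_add_le', Pi.one_apply]
  change F (x - y) = ∫ t, (Iic x).indicator 1 (y + t) ∂F.measure
  rw [hshift, integral_indicator_one measurableSet_Iic, measureReal_Iic]

theorem conv_apply_comm (F G : CDF) (x : ℝ) : F.conv G x = G.conv F x := by
  rw [conv_apply_eq_measureReal, conv_apply_eq_measureReal, Measure.conv_comm]

/-- The Lebesgue–Stieltjes measure `dF` as a point of the space of probability measures, whose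
topology is that of weak convergence. -/
noncomputable def toProbabilityMeasure (F : CDF) : ProbabilityMeasure ℝ :=
  ⟨F.measure, inferInstance⟩

/-- The cdf `x ↦ μ (-∞, x]` of a probability measure. -/
noncomputable def ofProbabilityMeasure (μ : ProbabilityMeasure ℝ) : CDF where
  toStieltjesFunction := ProbabilityTheory.cdf μ
  tendsto_atBot := ProbabilityTheory.tendsto_cdf_atBot μ
  tendsto_atTop := ProbabilityTheory.tendsto_cdf_atTop μ

theorem toProbabilityMeasure_ofProbabilityMeasure (μ : ProbabilityMeasure ℝ) :
    (ofProbabilityMeasure μ).toProbabilityMeasure = μ :=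
  Subtype.ext (ProbabilityTheory.measure_cdf (μ : Measure ℝ))

theorem ofProbabilityMeasure_apply (μ : ProbabilityMeasure ℝ) (x : ℝ) :
    ofProbabilityMeasure μ x = (μ : Measure ℝ).real (Iic x) :=
  ProbabilityTheory.cdf_eq_real _ x

theorem tendsto_conv_apply {u : ι → CDF}
    (hu : Tendsto (fun i => (u i).toProbabilityMeasure) l (𝓝 F.toProbabilityMeasure))
    (hG : Continuous G) (x : ℝ) :
    Tendsto (fun i => (u i).conv G x) l (𝓝 (F.conv G x)) := by
  -- By commutativity, `(F ⋆ G) x` is the integral of a bounded continuous function against `dF`.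
  let g : BoundedContinuousFunction ℝ ℝ :=
    .ofNormedAddCommGroup (fun y => G (x - y)) (by fun_prop) 1 fun y => G.norm_le_one (x - y)
  simp only [conv_apply_comm _ G]
  exact ProbabilityMeasure.tendsto_iff_forall_integral_tendsto.1 hu g

theorem tendsto_uniformDist_conv {u : ι → CDF}
    (hu : Tendsto (fun i => (u i).toProbabilityMeasure) l (𝓝 F.toProbabilityMeasure))
    (hG : Continuous G) :
    Tendsto (fun i => uniformDist (F.conv G) ((u i).conv G)) l (𝓝 0) :=
  tendsto_uniformDist_of_tendstoUniformly <|
    tendstoUniformly_of_tendsto (F.continuous_conv G hG) (tendsto_conv_apply hu hG)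

/-- The mass that `F` loses outside `[-M, M]`, in the form in which it enters `escapeIndex`. -/
def tailMass (F : CDF) (M : ℝ) : ℝ := max (F (-M)) (1 - F M)

theorem antitone_tailMass (F : CDF) : Antitone F.tailMass := fun _ _ h =>
  max_le_max (F.mono (neg_le_neg h)) (sub_le_sub_left (F.mono h) 1)

theorem tendsto_tailMass (F : CDF) : Tendsto F.tailMass atTop (𝓝 0) := by
  simpa using! (F.tendsto_atBot.comp tendsto_neg_atTop_atBot).max (F.tendsto_atTop.const_sub 1)

theorem tailMass_le_add_of_uniformDist_le {α : ℝ} (hα : 0 ≤ α)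
    (h : uniformDist F H ≤ ENNReal.ofReal α) (M : ℝ) : H.tailMass M ≤ F.tailMass M + α := by
  have hdist : ∀ x, |F x - H x| ≤ α := fun x =>
    (ENNReal.ofReal_le_ofReal_iff hα).1 ((le_iSup _ x).trans h)
  rw [tailMass, tailMass, ← max_add_add_right]
  exact max_le_max (by linarith [(abs_le.1 (hdist (-M))).1])
    (by linarith [(abs_le.1 (hdist M)).2])

section Clamp

variable (F : CDF) (a b : ℝ)

/-- The cdf obtained from `F` by moving all mass outside `[a, b]` to the nearest endpoint, as the
pushforward of `dF` under truncation to `[a, b]`. -/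
noncomputable def clamp : CDF :=
  ofProbabilityMeasure
    (F.toProbabilityMeasure.map (f := fun x => max a (min x b)) (by fun_prop))

theorem clamp_apply (x : ℝ) : F.clamp a b x = if x < a then 0 else if x < b then F x else 1 := by
  rw [clamp, ofProbabilityMeasure_apply, ProbabilityMeasure.toMeasure_map,
    map_measureReal_apply (by fun_prop) measurableSet_Iic]
  change F.measure.real {y | max a (min y b) ≤ x} = _
  split_ifs with ha hb
  · simp [not_le.2 ha]
  · simpa [not_lt.1 ha, not_le.2 hb, Iic] using F.measureReal_Iic x
  · simp [not_lt.1 ha, not_lt.1 hb]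

theorem toProbabilityMeasure_clamp_compl_Icc (hab : a ≤ b) :
    (F.clamp a b).toProbabilityMeasure (Icc a b)ᶜ = 0 := by
  rw [clamp, toProbabilityMeasure_ofProbabilityMeasure,
    ProbabilityMeasure.map_apply _ _ measurableSet_Icc.compl]
  have hempty : (fun x => max a (min x b)) ⁻¹' (Icc a b)ᶜ = ∅ := by
    ext x
    simp [hab]
  rw [hempty, ProbabilityMeasure.coeFn_empty]

theorem uniformDist_clamp_le (M : ℝ) :
    uniformDist F (F.clamp (-M) M) ≤ ENNReal.ofReal (F.tailMass M) := by
  refine iSup_le fun x => ENNReal.ofReal_le_ofReal ?_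
  rw [clamp_apply]
  split_ifs with hl hr
  · rw [sub_zero, abs_of_nonneg (F.nonneg x)]
    exact (F.mono hl.le).trans (le_max_left _ _)
  · rw [sub_self, abs_zero]
    exact (F.nonneg _).trans (le_max_left _ _)
  · rw [abs_sub_comm, abs_of_nonneg (sub_nonneg.2 (F.le_one x))]
    exact (sub_le_sub_left (F.mono (not_lt.1 hr)) 1).trans (le_max_right _ _)

end Clamp

theorem exists_subseq_tendsto_clamp {a b : ℝ} (hab : a ≤ b) (u : ℕ → CDF) :
    ∃ k : ℕ → ℕ, StrictMono k ∧ ∃ F : CDF,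
      Tendsto (fun n => ((u (k n)).clamp a b).toProbabilityMeasure) atTop
        (𝓝 F.toProbabilityMeasure) := by
  have hcompact : IsCompact {μ : ProbabilityMeasure ℝ | ∀ _ : ℕ, μ (Icc a b)ᶜ ≤ 0} :=
    isCompact_setOfPred_probabilityMeasure_mass_eq_compl_isCompact_le tendsto_const_nhds
      (fun _ => isCompact_Icc) (.inl inferInstance)
  obtain ⟨μ, -, k, hk, hμ⟩ := hcompact.tendsto_subseq
    (x := fun n => ((u n).clamp a b).toProbabilityMeasure)
    fun n _ => ((u n).toProbabilityMeasure_clamp_compl_Icc a b hab).le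
  refine ⟨k, hk, ofProbabilityMeasure μ, ?_⟩
  rwa [toProbabilityMeasure_ofProbabilityMeasure]

/-- The cdf of the uniform distribution on `[0, 1]`. -/
def uniform : CDF where
  toFun x := max 0 (min 1 x)
  mono' _ _ h := max_le_max_left 0 (min_le_min_left 1 h)
  right_continuous' _ :=
    (continuous_const.max (continuous_const.min continuous_id)).continuousWithinAt
  tendsto_atBot := by
    refine tendsto_const_nhds.congr' ?_
    filter_upwards [Iic_mem_atBot (0 : ℝ)] with x hx
    exact (max_eq_left ((min_le_right _ _).trans hx)).symm
  tendsto_atTop := by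
    refine tendsto_const_nhds.congr' ?_
    filter_upwards [Ici_mem_atTop (1 : ℝ)] with x hx
    rw [min_eq_left hx, max_eq_right zero_le_one]

theorem continuous_uniform : Continuous uniform :=
  continuous_const.max (continuous_const.min continuous_id)

theorem ae_mem_Ioc_uniform : ∀ᵐ y ∂uniform.measure, y ∈ Ioc (0 : ℝ) 1 := by
  refine (mem_ae_iff_prob_eq_one measurableSet_Ioc).2 ?_
  rw [measure, StieltjesFunction.measure_Ioc]
  change ENNReal.ofReal (max 0 (min 1 1) - max 0 (min 1 0)) = 1
  simp

theorem conv_uniform_mem_Icc (F : CDF) (x : ℝ) : F.conv uniform x ∈ Icc (F (x - 1)) (F x) := by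
  have hmem : ∀ᵐ y ∂uniform.measure, F (x - y) ∈ Icc (F (x - 1)) (F x) := by
    filter_upwards [ae_mem_Ioc_uniform] with y hy
    exact ⟨F.mono (by linarith [hy.2]), F.mono (by linarith [hy.1])⟩
  exact (convex_Icc _ _).integral_mem isClosed_Icc hmem (F.integrable_shift uniform x)

theorem tailMass_add_one_le (F : CDF) (M : ℝ) :
    F.tailMass (M + 1) ≤ (F.conv uniform).tailMass M := by
  refine max_le_max ?_ (sub_le_sub_left ?_ 1)
  · rw [neg_add']
    exact (F.conv_uniform_mem_Icc (-M)).1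
  · exact (F.conv_uniform_mem_Icc M).2.trans (F.mono (le_add_of_nonneg_right zero_le_one))

end CDF

open CDF

section ContinuityApproach

variable {D : Set CDF} {u : ℕ → CDF} {F : CDF} {α β ε M : ℝ}

theorem convergesUpTo_uniformApproach_iff {v : ℕ → ContCDF} {H : ContCDF} :
    uniformApproach.ConvergesUpTo ε v H ↔
      ∀ᶠ n in atTop, uniformDist H.1 (v n).1 < ENNReal.ofReal ε :=
  ApproachSystem.convergesUpTo_ofDist_iff

theorem isContraction_conv (G : ContCDF) :
    continuityApproach.IsContraction uniformApproach
      fun F => ⟨F.conv G.1, F.continuous_conv G.1 G.2⟩ :=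
  ApproachSystem.isContraction_initial (fun _ => uniformApproach) _ G

theorem eventually_uniformDist_conv_lt (h : continuityApproach.ConvergesUpTo ε u F)
    (G : ContCDF) :
    ∀ᶠ n in atTop, uniformDist (F.conv G.1) ((u n).conv G.1) < ENNReal.ofReal ε := by
  have hconv := (isContraction_conv G).convergesUpTo h
  rwa [convergesUpTo_uniformApproach_iff] at hconv

theorem convergesUpTo_continuityApproach (hε : 0 < ε) (hαε : α < ε)
    (h : ∀ G : ContCDF,
      ∀ᶠ n in atTop, uniformDist (F.conv G.1) ((u n).conv G.1) < ENNReal.ofReal α) :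
    continuityApproach.ConvergesUpTo ε u F :=
  ApproachSystem.convergesUpTo_initial_of_lt _ _ hε hαε fun G =>
    convergesUpTo_uniformApproach_iff.2 (h G)

theorem convergesUpTo_continuityApproach_of_tendsto {v : ℕ → CDF} {a : ℝ≥0∞}
    (hv : Tendsto (fun n => (v n).toProbabilityMeasure) atTop (𝓝 F.toProbabilityMeasure))
    (huv : ∀ n, uniformDist (v n) (u n) ≤ a) (ha : a < ENNReal.ofReal ε) :
    continuityApproach.ConvergesUpTo ε u F := by
  obtain ⟨α, -, haα, hαε⟩ := ENNReal.lt_iff_exists_real_btwn.1 ha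
  have hε : 0 < ε := ENNReal.ofReal_pos.1 (bot_le.trans_lt ha)
  refine convergesUpTo_continuityApproach hε ((ENNReal.ofReal_lt_ofReal_iff hε).1 hαε) fun G => ?_
  have hlim : Tendsto (fun n => uniformDist (F.conv G.1) ((v n).conv G.1) + a) atTop (𝓝 a) := by
    simpa using (tendsto_uniformDist_conv hv G.2).add_const a
  filter_upwards [hlim.eventually (gt_mem_nhds haα)] with n hn
  calc uniformDist (F.conv G.1) ((u n).conv G.1)
      ≤ uniformDist (F.conv G.1) ((v n).conv G.1)
          + uniformDist ((v n).conv G.1) ((u n).conv G.1) := uniformDist_triangle _ _ _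
    _ ≤ uniformDist (F.conv G.1) ((v n).conv G.1) + a := by
        gcongr
        exact (uniformDist_conv_le _ _ _).trans (huv n)
    _ < ENNReal.ofReal α := hn

theorem isRelSeqCompactUpTo_of_tailMass_le {a : ℝ≥0∞} (hM : 0 ≤ M)
    (hD : ∀ F ∈ D, ENNReal.ofReal (F.tailMass M) ≤ a) (ha : a < ENNReal.ofReal ε) :
    continuityApproach.IsRelSeqCompactUpTo ε D := by
  intro u hu
  obtain ⟨k, hk, F, hF⟩ := exists_subseq_tendsto_clamp (neg_le_self hM) u
  refine ⟨k, hk, F, convergesUpTo_continuityApproach_of_tendsto hF (fun n => ?_) ha⟩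
  rw [uniformDist_comm]
  exact (uniformDist_clamp_le _ M).trans (hD _ (hu (k n)))

theorem exists_eventually_tailMass_lt (hα : 0 ≤ α) (hαβ : α < β)
    (h : continuityApproach.ConvergesUpTo α u F) :
    ∃ M, ∀ᶠ n in atTop, (u n).tailMass M < β := by
  obtain ⟨M, hM⟩ :=
    ((F.conv uniform).tendsto_tailMass.eventually (gt_mem_nhds (sub_pos.2 hαβ))).exists
  refine ⟨M + 1, ?_⟩
  filter_upwards [eventually_uniformDist_conv_lt h ⟨uniform, continuous_uniform⟩] with n hn
  calc (u n).tailMass (M + 1)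
      ≤ ((u n).conv uniform).tailMass M := tailMass_add_one_le _ M
    _ ≤ (F.conv uniform).tailMass M + α := tailMass_le_add_of_uniformDist_le hα hn.le M
    _ < β := lt_sub_iff_add_lt.1 hM

theorem exists_forall_tailMass_lt (hα : 0 ≤ α) (hαβ : α < β)
    (hD : continuityApproach.IsRelSeqCompactUpTo α D) :
    ∃ M, 0 < M ∧ ∀ F ∈ D, F.tailMass M < β := by
  by_contra! hescape
  choose u hu hβu using fun n : ℕ => hescape (n + 1) n.cast_add_one_pos
  obtain ⟨k, hk, F, hF⟩ := hD u hu
  obtain ⟨M, hM⟩ := exists_eventually_tailMass_lt hα hαβ hF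
  have hkM : ∀ᶠ n in atTop, M ≤ k n :=
    (tendsto_natCast_atTop_atTop.comp hk.tendsto_atTop).eventually_ge_atTop M
  obtain ⟨n, hn, hMn⟩ := (hM.and hkM).exists
  have hanti := (u (k n)).antitone_tailMass (hMn.trans (lt_add_one (k n : ℝ)).le)
  exact ((hβu (k n)).trans hanti).not_gt hn

end ContinuityApproach

theorem theorem3p13 (D : Set CDF) :
    continuityApproach.relSeqCompactIndex D = escapeIndex D := by
  refine le_antisymm (le_of_forall_gt fun c hc => ?_)
    (le_iInf fun α => le_iInf₂ fun hα hD => le_of_forall_gt fun c hc => ?_)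
  · simp only [escapeIndex, iInf_lt_iff] at hc
    obtain ⟨M, hM, hc⟩ := hc
    obtain ⟨ε, -, hε, hεc⟩ := ENNReal.lt_iff_exists_real_btwn.1 hc
    have hcompact : continuityApproach.IsRelSeqCompactUpTo ε D :=
      isRelSeqCompactUpTo_of_tailMass_le hM.le
        (le_iSup₂ (f := fun F (_ : F ∈ D) => ENNReal.ofReal (F.tailMass M))) hε
    have hε0 : 0 < ε := ENNReal.ofReal_pos.1 (bot_le.trans_lt hε)
    exact (iInf_le_of_le ε (iInf₂_le hε0 hcompact)).trans_lt hεc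
  · obtain ⟨β, -, hαβ, hβc⟩ := ENNReal.lt_iff_exists_real_btwn.1 hc
    obtain ⟨M, hM, htail⟩ := exists_forall_tailMass_lt hα.le
      ((ENNReal.ofReal_lt_ofReal_iff_of_nonneg hα.le).1 hαβ) hD
    have hsup : ⨆ F ∈ D, ENNReal.ofReal (F.tailMass M) ≤ ENNReal.ofReal β :=
      iSup₂_le fun F hF => ENNReal.ofReal_le_ofReal (htail F hF).le
    exact (iInf₂_le_of_le M hM hsup).trans_lt hβc
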